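/- For real $\rho>0$ and complex $\mu,z$ let $E_{\rho,\mu}(z)=\sum_{k=0}^{\infty}\frac{z^k}{\Gamma(\mu+k/\rho)}$ be the two-parameter Mittag-Leffler function (with $1/\Gamma=0$ at the poles of $\Gamma$). For $z\neq0$ let $\arg z\in[0,2\pi)$, and for $r>0$, $a\in\mathbb C$ put $$(zr)^a=\exp\{a(\ln(|z|r)+i\arg z)\},\qquad (zre^{-i\pi})^a=(zr)^a e^{-i\pi a}.$$ Let $$\eta(r,\varphi,z)=(zr)^{\rho}e^{-i\rho\pi}\sin(\rho\varphi)+\rho(1-\mu)\varphi,$$ $$K_{\rho,\mu}(r,\varphi,z)=\frac{\rho}{\pi}(zre^{-i\pi})^{\rho(1-\mu)}\exp\left\{(zre^{-i\pi})^\rho \cos(\rho\varphi)\right\}\frac{r\sin(\eta(r,\varphi,z))+\sin(\eta(r,\varphi,z)+\varphi)}{r^2+2r\cos\varphi+1},$$ $$K_{\rho,\mu}(r,z)=\frac{\rho}{\pi}(zre^{-i\pi})^{\rho(1-\mu)}\exp\left\{-(zre^{-i\pi})^\rho\right\}\frac{r\sin(\pi(1-\mu))+\sin(\pi(1-\mu)+\pi/\rho)}{r^2+2r\cos(\pi/\rho)+1}.$$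 Let $\rho>1/2$ be real and let $\mu\in\mathbb C$ satisfy $\Re\mu<1+\frac1\rho$. 1. Let $\delta_\rho$ be real with $\frac{\pi}{2\rho}<\delta_\rho\le\frac{\pi}{\rho}$ if $\rho>1$, and $\frac{\pi}{2\rho}<\delta_\rho<\pi$ if $\frac12<\rho\le1$. Then for every complex $z\ne0$ with $\frac{\pi}{2\rho}-\delta_\rho+\pi<\arg z<-\frac{\pi}{2\rho}+\delta_\rho+\pi$ the function $r\mapsto K_{\rho,\mu}(r,\delta_\rho,z)$ is integrable on $(0,\infty)$ and $$E_{\rho,\mu}(z)=\int_0^\infty K_{\rho,\mu}(r,\delta_\rho,z)\,dr.$$ 2. If $\rho>1$ (the case $\delta_\rho=\pi/\rho$), then for every complex $z\ne0$ with $-\frac{\pi}{2\rho}+\pi<\arg z<\frac{\pi}{2\rho}+\pi$ the function $r\mapsto K_{\rho,\mu}(r,z)$ is integrable on $(0,\infty)$ and $$E_{\rho,\mu}(z)=\int_0^\infty K_{\rho,\mu}(r,z)\,dr.$$ -/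

import Mathlib

noncomputable section

/-- The two-parameter Mittag-Leffler function `E_{ρ,μ}(z) = ∑ z^k / Γ(μ + k/ρ)`.
The reciprocal Gamma function is taken to vanish at the poles of `Γ`; this is what the
division in Lean gives, as `Complex.Gamma` is `0` there. -/
def mittagLefflerE (ρ : ℝ) (μ z : ℂ) : ℂ :=
  ∑' k : ℕ, z ^ k / Complex.Gamma (μ + (k : ℂ) / (ρ : ℂ))

/-- The argument of `z ≠ 0` in `[0, 2π)`, with the cut along the positive real half-axis. -/
def argCut (z : ℂ) : ℝ :=
  if 0 ≤ Complex.arg z then Complex.arg z else Complex.arg z + 2 * Real.pi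

/-- The power `w ^ a`, for `w ≠ 0`, taken with the argument of `w` in `[0, 2π)`. -/
def powCut (w a : ℂ) : ℂ :=
  Complex.exp (a * ((Real.log ‖w‖ : ℂ) + Complex.I * (argCut w : ℂ)))

/-- The power `(w e^{-iπ}) ^ a = w ^ a e^{-iπa}`, for `w ≠ 0`, that is, the power in which
`w e^{-iπ}` has the argument `argCut w - π`. -/
def powRot (w a : ℂ) : ℂ :=
  powCut w a * Complex.exp (-(Complex.I * (Real.pi : ℂ) * a))

/-- `η(r, φ, z) = (zr)^ρ e^{-iρπ} sin(ρφ) + ρ(1-μ)φ`. -/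
def etaML (ρ : ℝ) (μ : ℂ) (r φ : ℝ) (z : ℂ) : ℂ :=
  powCut (z * r) ρ * Complex.exp (-(Complex.I * (ρ : ℂ) * (Real.pi : ℂ))) * (Real.sin (ρ * φ) : ℂ)
    + (ρ : ℂ) * (1 - μ) * (φ : ℂ)

/-- The kernel `K_{ρ,μ}(r, φ, z)`. -/
def kernelML (ρ : ℝ) (μ : ℂ) (r φ : ℝ) (z : ℂ) : ℂ :=
  (ρ / Real.pi : ℂ) * powRot (z * r) (ρ * (1 - μ))
    * Complex.exp (powRot (z * r) ρ * (Real.cos (ρ * φ) : ℂ))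
    * (((r : ℂ) * Complex.sin (etaML ρ μ r φ z) + Complex.sin (etaML ρ μ r φ z + (φ : ℂ)))
        / ((r ^ 2 + 2 * r * Real.cos φ + 1 : ℝ) : ℂ))

/-- The kernel `K_{ρ,μ}(r, z)`. -/
def kernelML₂ (ρ : ℝ) (μ : ℂ) (r : ℝ) (z : ℂ) : ℂ :=
  (ρ / Real.pi : ℂ) * powRot (z * r) (ρ * (1 - μ))
    * Complex.exp (-powRot (z * r) ρ)
    * (((r : ℂ) * Complex.sin (Real.pi * (1 - μ))
          + Complex.sin (Real.pi * (1 - μ) + ((Real.pi / ρ : ℝ) : ℂ)))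
        / ((r ^ 2 + 2 * r * Real.cos (Real.pi / ρ) + 1 : ℝ) : ℂ))

end

/-! Write `z = -exp ℓ` with `Im ℓ = arg z - π` and put `a = ρ(1-μ)`. In the coordinate `w` with `r =
e^w`, Hankel's formula represents each coefficient `1/Γ(μ + k/ρ)` as a contour integral of
`exp(e^{ρ(w+ℓ)}) e^{(a-k)w}` (`hankelInt_hankelFun`). The contour stays in `Re w ≥ 1`, so the
Mittag-Leffler series sums under the integral as a geometric series in `-e^{-w}`
(`hasSum_mittagLefflerE`).

The summed integrand is `exp(e^{ρ(w+ℓ)}) e^{(a+1)w} / (1+e^w)`. It has no pole in `|Im w| ≤ δ < π`,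
and it decays as `Re w → -∞` exactly because `Re(a+1) > 0`, that is `Re μ < 1 + 1/ρ`. Cauchy's
theorem then pushes the vertical side to `-∞` and leaves the two lines `Im w = ±δ`
(`hankelInt_hankelQuot`). Their difference, in the variable `r = e^x`, is the kernel
(`exp_smul_kernelML`). The sector condition on `arg z` makes `Re e^{ρ(w+ℓ)}` negative on both lines.

Hankel's formula itself is proved for `Re b > 0` by the same collapse: each line gives a Gamma
integral, and the reflection formula combines the two. The identity theorem extends it to all `b`.
-/

section MittagLeffler

open MeasureTheory Set Filter Topology

/-! ### Logarithmic substitution and real decay estimates. -/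

/-- Change of variables `r = exp x` for integrability on the positive half-axis. -/
theorem integrableOn_Ioi_zero_iff_comp_exp {E : Type*} [NormedAddCommGroup E] [NormedSpace ℝ E]
    (g : ℝ → E) :
    IntegrableOn g (Ioi 0) ↔ Integrable (fun x : ℝ => Real.exp x • g (Real.exp x)) := by
  have h := integrableOn_image_iff_integrableOn_abs_deriv_smul (s := univ) (f := Real.exp)
    (f' := Real.exp) MeasurableSet.univ (fun x _ => (Real.hasDerivAt_exp x).hasDerivWithinAt)
    Real.exp_injective.injOn g
  rw [image_univ, Real.range_exp] at h
  simpa only [abs_of_pos (Real.exp_pos _), integrableOn_univ] using h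

/-- Change of variables `r = exp x` for integrals over the positive half-axis. -/
theorem integral_Ioi_zero_eq_comp_exp {E : Type*} [NormedAddCommGroup E] [NormedSpace ℝ E]
    (g : ℝ → E) :
    ∫ r in Ioi (0 : ℝ), g r = ∫ x : ℝ, Real.exp x • g (Real.exp x) := by
  have h := integral_image_eq_integral_abs_deriv_smul (s := univ) (f := Real.exp)
    (f' := Real.exp) MeasurableSet.univ (fun x _ => (Real.hasDerivAt_exp x).hasDerivWithinAt)
    Real.exp_injective.injOn g
  rw [image_univ, Real.range_exp] at h
  simpa only [abs_of_pos (Real.exp_pos _), setIntegral_univ] using h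

theorem integrable_exp_neg_mul_exp_mul_exp {q β : ℝ} (hq : 0 < q) (hβ : 0 < β) :
    Integrable (fun x : ℝ => Real.exp (-(q * Real.exp x)) * Real.exp (β * x)) := by
  have h := integrableOn_rpow_mul_exp_neg_mul_rpow (p := 1) (s := β - 1) (b := q)
    (by linarith) one_pos hq
  rw [integrableOn_Ioi_zero_iff_comp_exp] at h
  refine h.congr (ae_of_all _ fun x => ?_)
  simp only [smul_eq_mul, Real.rpow_one]
  rw [← Real.exp_mul, ← mul_assoc, ← Real.exp_add, mul_comm]
  ring_nf

theorem tendsto_exp_neg_mul_exp_mul_exp_atTop {q : ℝ} (hq : 0 < q) (β : ℝ) :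
    Tendsto (fun x : ℝ => Real.exp (-(q * Real.exp x)) * Real.exp (β * x)) atTop (𝓝 0) := by
  have h := (tendsto_rpow_mul_exp_neg_mul_atTop_nhds_zero β q hq).comp Real.tendsto_exp_atTop
  refine h.congr fun x => ?_
  simp only [Function.comp]
  rw [← Real.exp_mul, mul_comm, mul_comm x β, neg_mul]

theorem tendsto_exp_mul_atBot {β : ℝ} (hβ : 0 < β) :
    Tendsto (fun x : ℝ => Real.exp (β * x)) atBot (𝓝 0) :=
  Real.tendsto_exp_atBot.comp (tendsto_id.const_mul_atBot hβ)

/-! ### Cauchy's theorem on horizontal strips. -/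

/-- Cauchy's theorem on a half-strip that extends to the left. -/
theorem integral_Iic_sub_of_differentiableAt_strip {f : ℂ → ℂ} {s t X : ℝ} {u : ℝ → ℝ}
    (hst : s ≤ t)
    (hf : ∀ w : ℂ, w.im ∈ Icc s t → DifferentiableAt ℂ f w)
    (hu : ∀ x y : ℝ, x ≤ X → y ∈ Icc s t → ‖f (x + y * Complex.I)‖ ≤ u x)
    (hu0 : Tendsto u atBot (𝓝 0))
    (hs : IntegrableOn (fun x : ℝ => f (x + s * Complex.I)) (Iic X))
    (ht : IntegrableOn (fun x : ℝ => f (x + t * Complex.I)) (Iic X)) :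
    (∫ x in Iic X, f (x + t * Complex.I)) - ∫ x in Iic X, f (x + s * Complex.I)
      = Complex.I * ∫ y in s..t, f (X + y * Complex.I) := by
  have hrect : ∀ T : ℝ,
      (∫ x in T..X, f (x + t * Complex.I)) - (∫ x in T..X, f (x + s * Complex.I))
        = Complex.I * (∫ y in s..t, f (X + y * Complex.I))
          - Complex.I * ∫ y in s..t, f (T + y * Complex.I) := by
    intro T
    have h := Complex.integral_boundary_rect_eq_zero_of_differentiableOn f
      (T + s * Complex.I) (X + t * Complex.I) (by
        intro w hw
        refine (hf w ?_).differentiableWithinAt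
        have := hw.2
        simpa [uIcc_of_le hst] using this)
    simp only [Complex.add_re, Complex.ofReal_re, Complex.mul_re, Complex.I_re, mul_zero,
      Complex.ofReal_im, Complex.I_im, mul_one, sub_self, add_zero, Complex.add_im,
      Complex.mul_im, zero_add, smul_eq_mul] at h
    linear_combination -h
  have h1 := (intervalIntegral_tendsto_integral_Iic X ht tendsto_id).sub
    (intervalIntegral_tendsto_integral_Iic X hs tendsto_id)
  have h2 : Tendsto (fun T : ℝ => Complex.I * ∫ y in s..t, f (T + y * Complex.I)) atBot (𝓝 0) := by
    have h3 : Tendsto (fun T : ℝ => u T * |t - s|) atBot (𝓝 0) := by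
      simpa using hu0.mul_const |t - s|
    refine squeeze_zero_norm' ?_ h3
    filter_upwards [eventually_le_atBot X] with T hT
    rw [norm_mul, Complex.norm_I, one_mul]
    refine intervalIntegral.norm_integral_le_of_norm_le_const fun y hy => hu T y hT ?_
    rw [uIoc_of_le hst] at hy
    exact Ioc_subset_Icc_self hy
  have h4 := (tendsto_const_nhds (x := Complex.I * ∫ y in s..t, f (X + y * Complex.I))).sub h2
  rw [sub_zero] at h4
  refine tendsto_nhds_unique h1 (h4.congr fun T => ?_)
  exact (hrect T).symm

/-- Cauchy's theorem on a full strip. -/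
theorem integral_horizontal_line_eq {f : ℂ → ℂ} {s t : ℝ} {u : ℝ → ℝ} (hst : s ≤ t)
    (hf : ∀ w : ℂ, w.im ∈ Icc s t → DifferentiableAt ℂ f w)
    (hu : ∀ x y : ℝ, y ∈ Icc s t → ‖f (x + y * Complex.I)‖ ≤ u x)
    (hbot : Tendsto u atBot (𝓝 0)) (htop : Tendsto u atTop (𝓝 0))
    (hs : Integrable (fun x : ℝ => f (x + s * Complex.I)))
    (ht : Integrable (fun x : ℝ => f (x + t * Complex.I))) :
    ∫ x : ℝ, f (x + t * Complex.I) = ∫ x : ℝ, f (x + s * Complex.I) := by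
  have hX : ∀ X : ℝ,
      (∫ x in Iic X, f (x + t * Complex.I)) - ∫ x in Iic X, f (x + s * Complex.I)
      = Complex.I * ∫ y in s..t, f (X + y * Complex.I) := fun X =>
    integral_Iic_sub_of_differentiableAt_strip hst hf (fun x y _ hy => hu x y hy) hbot
      hs.integrableOn ht.integrableOn
  have h1 := ((aecover_Iic (μ := volume) (tendsto_id (α := ℝ) (x := atTop))
      ).integral_tendsto_of_countably_generated ht).sub
    ((aecover_Iic (μ := volume) (tendsto_id (α := ℝ) (x := atTop))
      ).integral_tendsto_of_countably_generated hs)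
  have h2 : Tendsto (fun X : ℝ => Complex.I * ∫ y in s..t, f (X + y * Complex.I)) atTop (𝓝 0) := by
    have h3 : Tendsto (fun T : ℝ => u T * |t - s|) atTop (𝓝 0) := by
      simpa using htop.mul_const |t - s|
    refine squeeze_zero_norm (fun X => ?_) h3
    rw [norm_mul, Complex.norm_I, one_mul]
    refine intervalIntegral.norm_integral_le_of_norm_le_const fun y hy => hu X y ?_
    rw [uIoc_of_le hst] at hy
    exact Ioc_subset_Icc_self hy
  exact sub_eq_zero.mp (tendsto_nhds_unique h1 (h2.congr fun X => (hX X).symm))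

/-! ### Gamma integrals along rotated rays. -/

theorem norm_cexp_neg_cexp_mul_cexp (b w : ℂ) :
    ‖Complex.exp (-Complex.exp w) * Complex.exp (b * w)‖
      = Real.exp (-(Real.cos w.im * Real.exp w.re)) * Real.exp (b.re * w.re - b.im * w.im) := by
  rw [norm_mul, Complex.norm_exp, Complex.norm_exp, Complex.neg_re, Complex.exp_re, Complex.mul_re,
    mul_comm (Real.exp _) (Real.cos _)]

/-- Cosine decreases away from `0`, so the edge of the strip `|y| ≤ |α|` has the weakest decay and
dominates every line inside it. -/
theorem norm_cexp_neg_cexp_mul_cexp_le (b : ℂ) {α : ℝ} (hα : |α| < Real.pi / 2) (x y : ℝ)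
    (hy : |y| ≤ |α|) :
    ‖Complex.exp (-Complex.exp (x + y * Complex.I)) * Complex.exp (b * (x + y * Complex.I))‖
      ≤ Real.exp (|b.im| * |α|) *
        (Real.exp (-(Real.cos α * Real.exp x)) * Real.exp (b.re * x)) := by
  rw [norm_cexp_neg_cexp_mul_cexp]
  have hcos : Real.cos α ≤ Real.cos y := by
    rw [← Real.cos_abs α, ← Real.cos_abs y]
    exact Real.cos_le_cos_of_nonneg_of_le_pi (abs_nonneg _) (by linarith [Real.pi_pos]) hy
  have him : -(b.im * y) ≤ |b.im| * |α| :=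
    (neg_le_abs _).trans ((abs_mul _ _).le.trans (by gcongr))
  simp only [Complex.add_re, Complex.ofReal_re, Complex.mul_re, Complex.I_re, mul_zero,
      Complex.ofReal_im, Complex.I_im, mul_one, sub_self, add_zero, Complex.add_im,
      Complex.mul_im, zero_add]
  rw [← Real.exp_add, ← Real.exp_add, ← Real.exp_add]
  refine Real.exp_le_exp.mpr ?_
  nlinarith [mul_le_mul_of_nonneg_right hcos (Real.exp_pos x).le]

theorem integrable_cexp_neg_cexp_mul_cexp_line {b : ℂ} (hb : 0 < b.re) {α : ℝ}
    (hα : |α| < Real.pi / 2) :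
    Integrable (fun x : ℝ => Complex.exp (-Complex.exp (x + α * Complex.I))
      * Complex.exp (b * (x + α * Complex.I))) := by
  have hcos : 0 < Real.cos α := Real.cos_pos_of_mem_Ioo (abs_lt.mp hα)
  refine Integrable.mono'
    ((integrable_exp_neg_mul_exp_mul_exp hcos hb).const_mul (Real.exp (|b.im| * |α|)))
    (Continuous.aestronglyMeasurable (by fun_prop)) (ae_of_all _ fun x => ?_)
  exact norm_cexp_neg_cexp_mul_cexp_le b hα x α le_rfl

theorem integral_cexp_neg_cexp_mul_cexp {b : ℂ} (hb : 0 < b.re) :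
    ∫ x : ℝ, Complex.exp (-Complex.exp (x : ℂ)) * Complex.exp (b * x) = Complex.Gamma b := by
  rw [Complex.Gamma_eq_integral hb, Complex.GammaIntegral, integral_Ioi_zero_eq_comp_exp]
  refine integral_congr_ae (ae_of_all _ fun x => ?_)
  simp only [Complex.real_smul, Complex.ofReal_exp, Complex.ofReal_neg]
  rw [Complex.cpow_def_of_ne_zero (Complex.exp_ne_zero _), ← Complex.ofReal_exp,
    ← Complex.ofReal_log (Real.exp_pos x).le, Real.log_exp, Complex.ofReal_exp,
    ← Complex.exp_add, ← Complex.exp_add, ← Complex.exp_add]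
  ring_nf

/-- Euler's integral with its ray turned by the angle `α`: in the coordinate `w` this is a vertical
shift, to which Cauchy's theorem on the strip between `0` and `α` applies. -/
theorem integral_cexp_neg_cexp_mul_cexp_line {b : ℂ} (hb : 0 < b.re) {α : ℝ}
    (hα : |α| < Real.pi / 2) :
    ∫ x : ℝ, Complex.exp (-Complex.exp (x + α * Complex.I))
      * Complex.exp (b * (x + α * Complex.I)) = Complex.Gamma b := by
  have hcos : 0 < Real.cos α := Real.cos_pos_of_mem_Ioo (abs_lt.mp hα)
  set u : ℝ → ℝ := fun x => Real.exp (|b.im| * |α|) *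
        (Real.exp (-(Real.cos α * Real.exp x)) * Real.exp (b.re * x)) with hu
  have htop : Tendsto u atTop (𝓝 0) := by
    simpa using (tendsto_exp_neg_mul_exp_mul_exp_atTop hcos b.re).const_mul
      (Real.exp (|b.im| * |α|))
  have hbot : Tendsto u atBot (𝓝 0) := by
    have h0 := (tendsto_exp_mul_atBot hb).const_mul (Real.exp (|b.im| * |α|))
    rw [mul_zero] at h0
    refine squeeze_zero (fun x => by positivity) (fun x => ?_) h0
    refine mul_le_mul_of_nonneg_left ?_ (Real.exp_pos _).le
    refine mul_le_of_le_one_left (Real.exp_pos _).le (Real.exp_le_one_iff.mpr ?_)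
    have := mul_pos hcos (Real.exp_pos x)
    linarith
  set f : ℂ → ℂ := fun w => Complex.exp (-Complex.exp w) * Complex.exp (b * w) with hfdef
  have hd : Differentiable ℂ f := by fun_prop
  have hline : ∀ y : ℝ, |y| ≤ |α| → Integrable fun x : ℝ => f (x + y * Complex.I) := fun y hy =>
    integrable_cexp_neg_cexp_mul_cexp_line hb (hy.trans_lt hα)
  have h0 : |(0 : ℝ)| ≤ |α| := by simp
  have hzero : ∫ x : ℝ, f (x + (0 : ℝ) * Complex.I) = Complex.Gamma b := by
    rw [← integral_cexp_neg_cexp_mul_cexp hb]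
    simp [hfdef]
  rw [← hzero]
  rcases le_total 0 α with h | h
  · refine integral_horizontal_line_eq (u := u) h (fun w _ => hd w) (fun x y hy => ?_) hbot htop
      (hline 0 h0) (hline α le_rfl)
    exact norm_cexp_neg_cexp_mul_cexp_le b hα x y (abs_le_abs_of_nonneg hy.1 hy.2)
  · refine (integral_horizontal_line_eq (u := u) h (fun w _ => hd w) (fun x y hy => ?_) hbot htop
      (hline α le_rfl) (hline 0 h0)).symm
    exact norm_cexp_neg_cexp_mul_cexp_le b hα x y (abs_le_abs_of_nonpos hy.2 hy.1)

/-- The substitution `y = ρx + Re κ` reduces the ray to the normalised line at height `Im κ`. -/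
theorem cexp_ray_eq {ρ : ℝ} (hρ : 0 < ρ) (b κ : ℂ) (x : ℝ) :
    Complex.exp (-Complex.exp (ρ * x + κ)) * Complex.exp (b * x)
      = Complex.exp (-(b / ρ) * κ) *
        (Complex.exp (-Complex.exp (((x * ρ + κ.re : ℝ) : ℂ) + κ.im * Complex.I))
          * Complex.exp (b / ρ * (((x * ρ + κ.re : ℝ) : ℂ) + κ.im * Complex.I))) := by
  have hρ' : (ρ : ℂ) ≠ 0 := by exact_mod_cast hρ.ne'
  have h1 : ((x * ρ + κ.re : ℝ) : ℂ) + κ.im * Complex.I = ρ * x + κ := by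
    conv_rhs => rw [← Complex.re_add_im κ]
    push_cast
    ring
  rw [h1, mul_left_comm (Complex.exp (-(b / ρ) * κ)), ← Complex.exp_add (-(b / ρ) * κ)]
  congr 2
  field_simp
  ring

theorem integrable_cexp_ray {ρ : ℝ} (hρ : 0 < ρ) {b κ : ℂ} (hb : 0 < b.re)
    (hκ : |κ.im| < Real.pi / 2) :
    Integrable (fun x : ℝ => Complex.exp (-Complex.exp (ρ * x + κ)) * Complex.exp (b * x)) := by
  have hb' : 0 < (b / ρ).re := by rw [Complex.div_ofReal_re]; positivity
  have h := ((integrable_cexp_neg_cexp_mul_cexp_line hb' hκ).comp_add_right κ.re).comp_mul_right'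
    hρ.ne'
  simp_rw [cexp_ray_eq hρ]
  exact h.const_mul _

theorem integral_cexp_ray {ρ : ℝ} (hρ : 0 < ρ) {b κ : ℂ} (hb : 0 < b.re)
    (hκ : |κ.im| < Real.pi / 2) :
    ∫ x : ℝ, Complex.exp (-Complex.exp (ρ * x + κ)) * Complex.exp (b * x)
      = Complex.exp (-(b / ρ) * κ) * Complex.Gamma (b / ρ) / ρ := by
  have hb' : 0 < (b / ρ).re := by rw [Complex.div_ofReal_re]; positivity
  simp_rw [cexp_ray_eq hρ]
  rw [integral_const_mul]
  set G : ℝ → ℂ := fun y => Complex.exp (-Complex.exp ((y : ℂ) + κ.im * Complex.I))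
          * Complex.exp (b / ρ * ((y : ℂ) + κ.im * Complex.I)) with hG
  have h := Measure.integral_comp_mul_right (fun y => G (y + κ.re)) ρ
  rw [integral_add_right_eq_self G, integral_cexp_neg_cexp_mul_cexp_line hb' hκ,
    abs_of_pos (inv_pos.mpr hρ), Complex.real_smul, Complex.ofReal_inv] at h
  change _ * ∫ x : ℝ, G (x * ρ + κ.re) = _
  rw [h]
  ring

/-! ### Holomorphic dependence on a parameter and geometric series under the integral. -/

theorem differentiable_integral_mul_cexp {ν : Measure ℝ} {h ζ : ℝ → ℂ}
    (hh : AEStronglyMeasurable h ν) (hζ : Continuous ζ)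
    (hint : ∀ β : ℝ, Integrable (fun x => ‖h x‖ * Real.exp (β * ‖ζ x‖)) ν) :
    Differentiable ℂ fun b : ℂ => ∫ x, h x * Complex.exp (b * ζ x) ∂ν := by
  intro b₀
  have hle : ∀ (b : ℂ) (x : ℝ), ‖Complex.exp (b * ζ x)‖ ≤ Real.exp (‖b‖ * ‖ζ x‖) := fun b x =>
    (Complex.norm_exp_le_exp_norm _).trans (Real.exp_le_exp.mpr (norm_mul_le _ _))
  have hmeas : ∀ b : ℂ, AEStronglyMeasurable (fun x => h x * Complex.exp (b * ζ x)) ν := fun b =>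
    hh.mul (Continuous.aestronglyMeasurable (by fun_prop))
  refine (hasDerivAt_integral_of_dominated_loc_of_deriv_le
    (F := fun b x => h x * Complex.exp (b * ζ x))
    (F' := fun b x => h x * (Complex.exp (b * ζ x) * ζ x))
    -- One unit covers the ball of radius `1` around `b₀`; the other absorbs the factor `ζ x`
    -- through `t ≤ e^t`.
    (bound := fun x => ‖h x‖ * Real.exp ((‖b₀‖ + 1 + 1) * ‖ζ x‖))
    (Metric.ball_mem_nhds b₀ one_pos) (Eventually.of_forall hmeas) ?_ ?_ ?_ (hint _) ?_).2.differentiableAt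
  · refine (hint ‖b₀‖).mono' (hmeas b₀) (ae_of_all _ fun x => ?_)
    rw [norm_mul]
    gcongr
    exact hle b₀ x
  · exact hh.mul (Continuous.aestronglyMeasurable (by fun_prop))
  · refine ae_of_all _ fun x b hb => ?_
    rw [norm_mul, norm_mul, add_mul (‖b₀‖ + 1), one_mul, Real.exp_add]
    have hb' : ‖b‖ ≤ ‖b₀‖ + 1 := by
      have h1 := norm_le_norm_add_norm_sub' b b₀
      rw [Metric.mem_ball, dist_eq_norm] at hb
      linarith
    have h2 : ‖ζ x‖ ≤ Real.exp ‖ζ x‖ := by linarith [Real.add_one_le_exp ‖ζ x‖]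
    gcongr
    exact (hle b x).trans (Real.exp_le_exp.mpr (by gcongr))
  · refine ae_of_all _ fun x b _ => ?_
    have h1 : HasDerivAt (fun b : ℂ => b * ζ x) (ζ x) b := by
      simpa using (hasDerivAt_id b).mul_const (ζ x)
    exact h1.cexp.const_mul _

theorem hasSum_integral_geometric {ν : Measure ℝ} {F q : ℝ → ℂ} {κ : ℝ} (hF : Integrable F ν)
    (hq : AEStronglyMeasurable q ν) (hκ : κ < 1) (hκ0 : 0 ≤ κ) (hle : ∀ᵐ x ∂ν, ‖q x‖ ≤ κ) :
    HasSum (fun k : ℕ => ∫ x, F x * q x ^ k ∂ν) (∫ x, F x / (1 - q x) ∂ν) := by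
  have hbd : ∀ k : ℕ, ∀ᵐ x ∂ν, ‖F x * q x ^ k‖ ≤ ‖F x‖ * κ ^ k := fun k => by
    filter_upwards [hle] with x hx
    rw [norm_mul, norm_pow]
    gcongr
  have hint : ∀ k : ℕ, Integrable (fun x => F x * q x ^ k) ν := fun k =>
    (hF.norm.mul_const (κ ^ k)).mono' (hF.1.mul (hq.pow k)) (hbd k)
  have h := hasSum_integral_of_summable_integral_norm hint (by
    refine Summable.of_nonneg_of_le (fun k => integral_nonneg fun x => norm_nonneg _) (fun k => ?_)
      ((summable_geometric_of_lt_one hκ0 hκ).mul_left (∫ x, ‖F x‖ ∂ν))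
    rw [← integral_mul_const]
    exact integral_mono_ae (hint k).norm (hF.norm.mul_const _) (hbd k))
  convert! h using 1
  refine integral_congr_ae ?_
  filter_upwards [hle] with x hx
  rw [tsum_mul_left, tsum_geometric_of_norm_lt_one (hx.trans_lt hκ), div_eq_mul_inv]

/-! ### Hankel's formula in the logarithmic coordinate. -/

noncomputable section

/-- The integral of `f` along the contour that comes from `∞ - iδ` to `1 - iδ`, goes up to `1 + iδ`
and returns to `∞ + iδ`: the Hankel contour in a logarithmic coordinate. -/
def hankelInt (δ : ℝ) (f : ℂ → ℂ) : ℂ :=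
  Complex.I * (∫ y in (-δ)..δ, f (1 + y * Complex.I))
    + ((∫ x in Ioi (1 : ℝ), f (x + δ * Complex.I))
      - ∫ x in Ioi (1 : ℝ), f (x + (-δ : ℝ) * Complex.I))

/-- The function `exp (e^{ρ(w+ℓ)}) e^{bw}`. -/
def hankelFun (ρ : ℝ) (ℓ b w : ℂ) : ℂ :=
  Complex.exp (Complex.exp (ρ * (w + ℓ))) * Complex.exp (b * w)

end

theorem continuous_hankelFun (ρ : ℝ) (ℓ b : ℂ) : Continuous (hankelFun ρ ℓ b) := by
  unfold hankelFun; fun_prop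

theorem differentiable_hankelFun (ρ : ℝ) (ℓ b : ℂ) : Differentiable ℂ (hankelFun ρ ℓ b) := by
  unfold hankelFun; fun_prop

/-- `κ` is a logarithm of `-e^{ρ(ℓ+is)}`. The sign turns the double exponential into the integrand
of a Gamma integral, convergent when `|Im κ| < π/2`. -/
theorem hankelFun_line {ρ s : ℝ} {ℓ κ : ℂ}
    (h : Complex.exp κ = -Complex.exp (ρ * (ℓ + s * Complex.I))) (b : ℂ) (x : ℝ) :
    hankelFun ρ ℓ b (x + s * Complex.I) = Complex.exp (b * (s * Complex.I)) *
      (Complex.exp (-Complex.exp (ρ * x + κ)) * Complex.exp (b * x)) := by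
  rw [hankelFun, Complex.exp_add (ρ * x), h, mul_neg, neg_neg, ← Complex.exp_add (ρ * x), mul_left_comm,
    ← Complex.exp_add (b * _)]
  ring_nf

theorem integrable_hankelFun_line {ρ s : ℝ} {ℓ κ b : ℂ} (hρ : 0 < ρ)
    (h : Complex.exp κ = -Complex.exp (ρ * (ℓ + s * Complex.I))) (hκ : |κ.im| < Real.pi / 2)
    (hb : 0 < b.re) :
    Integrable (fun x : ℝ => hankelFun ρ ℓ b (x + s * Complex.I)) := by
  simp_rw [hankelFun_line h]
  exact (integrable_cexp_ray hρ hb hκ).const_mul _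

theorem integral_hankelFun_line {ρ s : ℝ} {ℓ κ b : ℂ} (hρ : 0 < ρ)
    (h : Complex.exp κ = -Complex.exp (ρ * (ℓ + s * Complex.I))) (hκ : |κ.im| < Real.pi / 2)
    (hb : 0 < b.re) :
    ∫ x : ℝ, hankelFun ρ ℓ b (x + s * Complex.I)
      = Complex.exp (b * (s * Complex.I)) *
        (Complex.exp (-(b / ρ) * κ) * Complex.Gamma (b / ρ) / ρ) := by
  simp_rw [hankelFun_line h]
  rw [integral_const_mul, integral_cexp_ray hρ hb hκ]

theorem norm_hankelFun (ρ : ℝ) (ℓ b : ℂ) (x y : ℝ) :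
    ‖hankelFun ρ ℓ b (x + y * Complex.I)‖
      = ‖Complex.exp (Complex.exp (ρ * (x + y * Complex.I + ℓ)))‖
        * (Real.exp (-(b.im * y)) * Real.exp (b.re * x)) := by
  rw [hankelFun, norm_mul, Complex.norm_exp (b * _), ← Real.exp_add]
  congr 2
  simp
  ring

/-- On the half-line the double exponential beats every `e^{βx}`, with no sign condition on `β`.
This is what makes the contour integral entire in `b`. -/
theorem integrableOn_Ioi_norm_mul_exp {ρ s : ℝ} {ℓ κ : ℂ} (hρ : 0 < ρ)
    (h : Complex.exp κ = -Complex.exp (ρ * (ℓ + s * Complex.I))) (hκ : |κ.im| < Real.pi / 2)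
    (β : ℝ) :
    IntegrableOn (fun x : ℝ => ‖Complex.exp (Complex.exp (ρ * (x + s * Complex.I + ℓ)))‖ *
      Real.exp (β * ‖(x : ℂ) + s * Complex.I‖)) (Ioi 1) := by
  -- The exponent is enlarged to `|β| + 1 > 0` so that integrability on the whole line can be used.
  have hB : 0 < ((|β| + 1 : ℝ) : ℂ).re := by rw [Complex.ofReal_re]; positivity
  refine Integrable.mono' (((integrable_hankelFun_line hρ h hκ hB).norm.const_mul
    (Real.exp (|β| * |s|))).integrableOn) (Continuous.aestronglyMeasurable (by fun_prop)) ?_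
  refine (ae_restrict_mem measurableSet_Ioi).mono fun x hx => ?_
  have hx1 : (1 : ℝ) < x := hx
  have hn : ‖(x : ℂ) + s * Complex.I‖ ≤ x + |s| := by
    refine (norm_add_le _ _).trans_eq ?_
    rw [norm_mul, Complex.norm_I, mul_one, Complex.norm_real, Complex.norm_real, Real.norm_eq_abs,
      Real.norm_eq_abs, abs_of_pos (by linarith)]
  have h1 : β * ‖(x : ℂ) + s * Complex.I‖ ≤ |β| * |s| + (|β| + 1) * x := by
    have := mul_le_mul (le_abs_self β) hn (norm_nonneg _) (abs_nonneg _)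
    linarith
  rw [norm_hankelFun, Complex.ofReal_im, zero_mul, neg_zero, Real.exp_zero, one_mul,
    Complex.ofReal_re, norm_mul, norm_norm, Real.norm_of_nonneg (Real.exp_pos _).le,
    mul_left_comm, ← Real.exp_add]
  gcongr

theorem integrableOn_Ioi_hankelFun_line {ρ s : ℝ} {ℓ κ : ℂ} (hρ : 0 < ρ)
    (h : Complex.exp κ = -Complex.exp (ρ * (ℓ + s * Complex.I))) (hκ : |κ.im| < Real.pi / 2)
    (b : ℂ) :
    IntegrableOn (fun x : ℝ => hankelFun ρ ℓ b (x + s * Complex.I)) (Ioi 1) := by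
  refine Integrable.mono' (integrableOn_Ioi_norm_mul_exp hρ h hκ ‖b‖)
    (Continuous.aestronglyMeasurable ((continuous_hankelFun ρ ℓ b).comp (by fun_prop)))
    (ae_of_all _ fun x => ?_)
  rw [hankelFun, norm_mul]
  gcongr
  exact (Complex.norm_exp_le_exp_norm _).trans (Real.exp_le_exp.mpr (norm_mul_le _ _))

theorem differentiable_integral_Ioi_hankelFun {ρ s : ℝ} {ℓ κ : ℂ} (hρ : 0 < ρ)
    (h : Complex.exp κ = -Complex.exp (ρ * (ℓ + s * Complex.I))) (hκ : |κ.im| < Real.pi / 2) :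
    Differentiable ℂ fun b : ℂ => ∫ x in Ioi (1 : ℝ), hankelFun ρ ℓ b (x + s * Complex.I) :=
  differentiable_integral_mul_cexp (Continuous.aestronglyMeasurable (by fun_prop)) (by fun_prop)
    (integrableOn_Ioi_norm_mul_exp hρ h hκ)

theorem differentiable_intervalIntegral_hankelFun (ρ : ℝ) {δ : ℝ} (hδ : 0 ≤ δ) (ℓ : ℂ) :
    Differentiable ℂ fun b : ℂ => ∫ y in (-δ)..δ, hankelFun ρ ℓ b (1 + y * Complex.I) := by
  simp_rw [intervalIntegral.integral_of_le (neg_le_self hδ)]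
  refine differentiable_integral_mul_cexp (Continuous.aestronglyMeasurable (by fun_prop))
    (by fun_prop) fun β => ?_
  exact (Continuous.integrableOn_Icc (by fun_prop)).mono_set Ioc_subset_Icc_self

theorem hankelInt_eq_integral_sub {f : ℂ → ℂ} {δ C β : ℝ} (hδ : 0 ≤ δ) (hβ : 0 < β)
    (hf : ∀ w : ℂ, w.im ∈ Icc (-δ) δ → DifferentiableAt ℂ f w)
    (hu : ∀ x y : ℝ, x ≤ 1 → y ∈ Icc (-δ) δ → ‖f (x + y * Complex.I)‖ ≤ C * Real.exp (β * x))
    (hs : Integrable (fun x : ℝ => f (x + (-δ : ℝ) * Complex.I)))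
    (ht : Integrable (fun x : ℝ => f (x + δ * Complex.I))) :
    hankelInt δ f
      = (∫ x : ℝ, f (x + δ * Complex.I)) - ∫ x : ℝ, f (x + (-δ : ℝ) * Complex.I) := by
  have h0 : Tendsto (fun x : ℝ => C * Real.exp (β * x)) atBot (𝓝 0) := by
    simpa using (tendsto_exp_mul_atBot hβ).const_mul C
  have h := integral_Iic_sub_of_differentiableAt_strip (neg_le_self hδ) hf hu h0
    hs.integrableOn ht.integrableOn
  rw [Complex.ofReal_one] at h
  rw [hankelInt, ← h, ← intervalIntegral.integral_Iic_add_Ioi hs.integrableOn hs.integrableOn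
    (b := 1), ← intervalIntegral.integral_Iic_add_Ioi ht.integrableOn ht.integrableOn (b := 1)]
  ring

theorem norm_hankelFun_le {ρ δ : ℝ} (hρ : 0 < ρ) (ℓ b : ℂ) {x y : ℝ} (hx : x ≤ 1)
    (hy : y ∈ Icc (-δ) δ) :
    ‖hankelFun ρ ℓ b (x + y * Complex.I)‖
      ≤ Real.exp (Real.exp (ρ * (1 + ℓ.re))) * Real.exp (|b.im| * δ) * Real.exp (b.re * x) := by
  rw [norm_hankelFun, ← mul_assoc]
  have h1 : -(b.im * y) ≤ |b.im| * δ :=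
    (neg_le_abs _).trans ((abs_mul _ _).le.trans
      (mul_le_mul_of_nonneg_left (abs_le.mpr hy) (abs_nonneg _)))
  have h2 : ‖Complex.exp (Complex.exp (ρ * (x + y * Complex.I + ℓ)))‖
      ≤ Real.exp (Real.exp (ρ * (1 + ℓ.re))) := by
    refine (Complex.norm_exp_le_exp_norm _).trans (Real.exp_le_exp.mpr ?_)
    rw [Complex.norm_exp, Complex.re_ofReal_mul]
    refine Real.exp_le_exp.mpr (mul_le_mul_of_nonneg_left ?_ hρ.le)
    simpa using hx
  gcongr

/-- The reflection formula in a form that survives the zeros of the sine: there `Γ(1-s)` takes the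
default value `0`, and both sides vanish. -/
theorem Complex.Gamma_mul_sin_eq {s : ℂ} (hs : 0 < s.re) :
    Complex.Gamma s * Complex.sin (Real.pi * s) = Real.pi * (Complex.Gamma (1 - s))⁻¹ := by
  have h := Complex.Gamma_mul_Gamma_one_sub s
  have hne := Complex.Gamma_ne_zero_of_re_pos hs
  by_cases h0 : Complex.sin (Real.pi * s) = 0
  · rw [h0, div_zero] at h
    rw [h0, (mul_eq_zero.mp h).resolve_left hne]
    simp
  · rw [eq_div_iff h0] at h
    have hpi : (Real.pi : ℂ) ≠ 0 := by exact_mod_cast Real.pi_ne_zero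
    have h1 : Complex.Gamma (1 - s) ≠ 0 := by
      intro h2
      rw [h2, mul_zero, zero_mul] at h
      exact hpi h.symm
    rw [eq_mul_inv_iff_mul_eq₀ h1]
    linear_combination h

/-- The logarithm shifted by `-πi` above and by `+πi` below is the branch whose imaginary part lies
within `π/2` of `0`. -/
theorem cexp_upper_eq (ρ δ : ℝ) (ℓ : ℂ) :
    Complex.exp (ρ * (ℓ + δ * Complex.I) - Real.pi * Complex.I)
      = -Complex.exp (ρ * (ℓ + δ * Complex.I)) := by
  rw [Complex.exp_sub, Complex.exp_pi_mul_I, div_neg, div_one]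

theorem cexp_lower_eq (ρ δ : ℝ) (ℓ : ℂ) :
    Complex.exp (ρ * (ℓ + (-δ : ℝ) * Complex.I) + Real.pi * Complex.I)
      = -Complex.exp (ρ * (ℓ + (-δ : ℝ) * Complex.I)) := by
  rw [Complex.exp_add, Complex.exp_pi_mul_I, mul_neg, mul_one]

theorem abs_im_upper {ρ δ : ℝ} {ℓ : ℂ} (h : |ρ * (ℓ.im + δ) - Real.pi| < Real.pi / 2) :
    |(ρ * (ℓ + δ * Complex.I) - Real.pi * Complex.I).im| < Real.pi / 2 := by
  simpa using h

theorem abs_im_lower {ρ δ : ℝ} {ℓ : ℂ} (h : |ρ * (ℓ.im - δ) + Real.pi| < Real.pi / 2) :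
    |(ρ * (ℓ + (-δ : ℝ) * Complex.I) + Real.pi * Complex.I).im| < Real.pi / 2 := by
  simpa [sub_eq_add_neg] using h

section

variable {ρ δ : ℝ} {ℓ : ℂ} (hρ : 0 < ρ) (hδ : 0 ≤ δ)
  (hup : |ρ * (ℓ.im + δ) - Real.pi| < Real.pi / 2)
  (hlo : |ρ * (ℓ.im - δ) + Real.pi| < Real.pi / 2)

include hρ hδ hup hlo

/-- For `Re b > 0` the contour collapses onto its two lines. Their Gamma integrals differ only in
the phases `e^{±πis}` with `s = b/ρ`, whose difference is `2i sin(πs)`. -/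
theorem hankelInt_hankelFun_of_re_pos {b : ℂ} (hb : 0 < b.re) :
    hankelInt δ (hankelFun ρ ℓ b)
      = 2 * Real.pi * Complex.I / ρ * Complex.exp (-(b * ℓ)) * (Complex.Gamma (1 - b / ρ))⁻¹ := by
  have hup' := abs_im_upper hup
  have hlo' := abs_im_lower hlo
  rw [hankelInt_eq_integral_sub hδ hb (fun w _ => differentiable_hankelFun ρ ℓ b w)
    (fun x y hx hy => norm_hankelFun_le hρ ℓ b hx hy)
    (integrable_hankelFun_line hρ (cexp_lower_eq ρ δ ℓ) hlo' hb)
    (integrable_hankelFun_line hρ (cexp_upper_eq ρ δ ℓ) hup' hb),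
    integral_hankelFun_line hρ (cexp_lower_eq ρ δ ℓ) hlo' hb,
    integral_hankelFun_line hρ (cexp_upper_eq ρ δ ℓ) hup' hb]
  have hρ' : (ρ : ℂ) ≠ 0 := by exact_mod_cast hρ.ne'
  have hs : 0 < (b / ρ).re := by rw [Complex.div_ofReal_re]; positivity
  have hG := Complex.Gamma_mul_sin_eq hs
  set s := b / ρ with hsdef
  have hbs : b = s * ρ := by rw [hsdef]; field_simp
  have e1 : Complex.exp (b * (δ * Complex.I)) *
      Complex.exp (-s * (ρ * (ℓ + δ * Complex.I) - Real.pi * Complex.I))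
      = Complex.exp (-(b * ℓ)) * Complex.exp (Real.pi * s * Complex.I) := by
    rw [← Complex.exp_add, ← Complex.exp_add, hbs]
    ring_nf
  have e2 : Complex.exp (b * ((-δ : ℝ) * Complex.I)) *
      Complex.exp (-s * (ρ * (ℓ + (-δ : ℝ) * Complex.I) + Real.pi * Complex.I))
      = Complex.exp (-(b * ℓ)) * Complex.exp (-(Real.pi * s) * Complex.I) := by
    rw [← Complex.exp_add, ← Complex.exp_add, hbs]
    push_cast
    ring_nf
  have e3 : Complex.exp (Real.pi * s * Complex.I) - Complex.exp (-(Real.pi * s) * Complex.I)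
      = 2 * Complex.I * Complex.sin (Real.pi * s) := by
    rw [Complex.sin]
    linear_combination (Complex.exp (Real.pi * s * Complex.I)
      - Complex.exp (-(Real.pi * s) * Complex.I)) * Complex.I_sq
  linear_combination Complex.Gamma s / ρ * e1 - Complex.Gamma s / ρ * e2
    + Complex.Gamma s / ρ * Complex.exp (-(b * ℓ)) * e3
    + 2 * Complex.I / ρ * Complex.exp (-(b * ℓ)) * hG

/-- Hankel's formula for the reciprocal Gamma function, in a logarithmic coordinate. -/
theorem hankelInt_hankelFun (b : ℂ) :
    hankelInt δ (hankelFun ρ ℓ b)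
      = 2 * Real.pi * Complex.I / ρ * Complex.exp (-(b * ℓ)) * (Complex.Gamma (1 - b / ρ))⁻¹ := by
  have hL : Differentiable ℂ fun b => hankelInt δ (hankelFun ρ ℓ b) :=
    ((differentiable_intervalIntegral_hankelFun ρ hδ ℓ).const_mul _).add
      ((differentiable_integral_Ioi_hankelFun hρ (cexp_upper_eq ρ δ ℓ) (abs_im_upper hup)).sub
        (differentiable_integral_Ioi_hankelFun hρ (cexp_lower_eq ρ δ ℓ) (abs_im_lower hlo)))
  have hR : Differentiable ℂ fun b : ℂ => 2 * Real.pi * Complex.I / ρ * Complex.exp (-(b * ℓ))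
      * (Complex.Gamma (1 - b / ρ))⁻¹ := by
    have h1 : Differentiable ℂ fun b : ℂ => (Complex.Gamma (1 - b / ρ))⁻¹ :=
      Complex.differentiable_one_div_Gamma.comp (by fun_prop)
    fun_prop
  -- Both sides are entire in `b` and agree near `b = 1`.
  refine congrFun (AnalyticOnNhd.eq_of_eventuallyEq (z₀ := 1) (fun b _ => hL.analyticAt b)
    (fun b _ => hR.analyticAt b) ?_) b
  filter_upwards [Complex.continuous_re.continuousAt.eventually_const_lt
    (show (0 : ℝ) < (1 : ℂ).re by simp)] with b hb
  exact hankelInt_hankelFun_of_re_pos hρ hδ hup hlo hb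

theorem hasSum_hankelInt_hankelFun_div (a : ℂ) :
    HasSum (fun k : ℕ => (-1) ^ k * hankelInt δ (hankelFun ρ ℓ (a - k)))
      (hankelInt δ fun w => hankelFun ρ ℓ a w / (1 + Complex.exp (-w))) := by
  have hterm : ∀ (k : ℕ) (w : ℂ), hankelFun ρ ℓ a w * (-Complex.exp (-w)) ^ k
      = (-1) ^ k * hankelFun ρ ℓ (a - k) w := by
    intro k w
    rw [hankelFun, hankelFun, neg_pow, ← Complex.exp_nat_mul, mul_left_comm, mul_assoc,
      ← Complex.exp_add]
    ring_nf
  have key : ∀ (ν : Measure ℝ) (γ : ℝ → ℂ), Continuous γ → (∀ᵐ x ∂ν, 1 ≤ (γ x).re) →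
      Integrable (fun x => hankelFun ρ ℓ a (γ x)) ν →
      HasSum (fun k : ℕ => (-1) ^ k * ∫ x, hankelFun ρ ℓ (a - k) (γ x) ∂ν)
        (∫ x, hankelFun ρ ℓ a (γ x) / (1 + Complex.exp (-γ x)) ∂ν) := by
    intro ν γ hγ hre hint
    -- On `Re w ≥ 1` the ratio `-e^{-w}` has norm at most `e^{-1}`.
    have h := hasSum_integral_geometric (q := fun x => -Complex.exp (-γ x)) (κ := Real.exp (-1))
      hint (Continuous.aestronglyMeasurable (by fun_prop)) (by simp) (Real.exp_pos _).le (by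
        filter_upwards [hre] with x hx
        rw [norm_neg, Complex.norm_exp]
        exact Real.exp_le_exp.mpr (neg_le_neg hx))
    simp_rw [hterm, integral_const_mul, sub_neg_eq_add] at h
    exact h
  have h1 := key (volume.restrict (Ioc (-δ) δ)) (fun y : ℝ => 1 + y * Complex.I) (by fun_prop)
    (ae_of_all _ fun y => by simp)
    (((continuous_hankelFun ρ ℓ a).comp (by fun_prop)).integrableOn_Icc.mono_set
      Ioc_subset_Icc_self)
  have hγ : ∀ s : ℝ, ∀ᵐ x : ℝ ∂volume.restrict (Ioi 1), 1 ≤ ((x : ℂ) + s * Complex.I).re :=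
    fun s => (ae_restrict_mem measurableSet_Ioi).mono fun x hx => by simpa using le_of_lt hx
  have h2 := key (volume.restrict (Ioi 1)) (fun x : ℝ => x + δ * Complex.I) (by fun_prop) (hγ _)
    (integrableOn_Ioi_hankelFun_line hρ (cexp_upper_eq ρ δ ℓ) (abs_im_upper hup) a)
  have h3 := key (volume.restrict (Ioi 1)) (fun x : ℝ => x + (-δ : ℝ) * Complex.I) (by fun_prop)
    (hγ _) (integrableOn_Ioi_hankelFun_line hρ (cexp_lower_eq ρ δ ℓ) (abs_im_lower hlo) a)
  have h := (h1.mul_left Complex.I).add (h2.sub h3)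
  simp only [hankelInt, intervalIntegral.integral_of_le (neg_le_self hδ)]
  convert! h using 2
  ring

end

/-! ### Collapsing the contour of the summed integrand. -/

/-- `|1+e^w|² = 1 + 2e^x cos y + e^{2x} ≥ (e^x + cos δ)² + sin² δ`, which keeps the denominator away
from `0` uniformly on the strip. -/
theorem sin_le_norm_one_add_cexp {δ : ℝ} (hδ : δ < Real.pi) (x : ℝ) {y : ℝ}
    (hy : y ∈ Icc (-δ) δ) :
    Real.sin δ ≤ ‖1 + Complex.exp (x + y * Complex.I)‖ := by
  have hcos : Real.cos δ ≤ Real.cos y := by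
    rw [← Real.cos_abs y]
    exact Real.cos_le_cos_of_nonneg_of_le_pi (abs_nonneg _) hδ.le (abs_le.mpr hy)
  refine le_of_sq_le_sq ?_ (norm_nonneg _)
  rw [← Complex.normSq_eq_norm_sq, Complex.normSq_apply]
  have hre : (1 + Complex.exp (x + y * Complex.I)).re = 1 + Real.exp x * Real.cos y := by
    simp [Complex.exp_re]
  have him : (1 + Complex.exp (x + y * Complex.I)).im = Real.exp x * Real.sin y := by
    simp [Complex.exp_im]
  have hsq : (1 + Real.exp x * Real.cos y) * (1 + Real.exp x * Real.cos y)
      + Real.exp x * Real.sin y * (Real.exp x * Real.sin y)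
      = 1 + 2 * (Real.exp x * Real.cos y) + Real.exp x ^ 2 := by
    linear_combination Real.exp x ^ 2 * Real.sin_sq_add_cos_sq y
  rw [hre, him, hsq]
  nlinarith [Real.sin_sq_add_cos_sq δ, sq_nonneg (Real.exp x + Real.cos δ),
    mul_le_mul_of_nonneg_left hcos (Real.exp_pos x).le]

theorem one_add_cexp_ne_zero {δ : ℝ} (hδ0 : 0 < δ) (hδ : δ < Real.pi) (x : ℝ) {y : ℝ}
    (hy : y ∈ Icc (-δ) δ) : 1 + Complex.exp (x + y * Complex.I) ≠ 0 :=
  norm_pos_iff.mp ((Real.sin_pos_of_pos_of_lt_pi hδ0 hδ).trans_le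
    (sin_le_norm_one_add_cexp hδ x hy))

theorem norm_div_one_add_cexp_le {δ : ℝ} (hδ0 : 0 < δ) (hδ : δ < Real.pi) (c : ℂ) (x : ℝ) {y : ℝ}
    (hy : y ∈ Icc (-δ) δ) :
    ‖c / (1 + Complex.exp (x + y * Complex.I))‖ ≤ (Real.sin δ)⁻¹ * ‖c‖ := by
  have hsin := Real.sin_pos_of_pos_of_lt_pi hδ0 hδ
  rw [norm_div, div_eq_inv_mul]
  gcongr
  exact sin_le_norm_one_add_cexp hδ x hy

noncomputable section

/-- The integrand `exp (e^{ρ(w+ℓ)}) e^{(a+1)w} / (1 + e^w)`. -/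
def hankelQuot (ρ : ℝ) (ℓ a w : ℂ) : ℂ :=
  hankelFun ρ ℓ (a + 1) w / (1 + Complex.exp w)

end

/-- The form over `1 + e^{-w}` is the sum of the geometric series; the form over `1 + e^w` shows the
decay rate `Re(a+1)` at `-∞`. -/
theorem hankelQuot_eq (ρ : ℝ) (ℓ a : ℂ) :
    hankelQuot ρ ℓ a = fun w => hankelFun ρ ℓ a w / (1 + Complex.exp (-w)) := by
  ext w
  have h : 1 + Complex.exp w = Complex.exp w * (1 + Complex.exp (-w)) := by
    rw [mul_add, mul_one, ← Complex.exp_add, add_neg_cancel, Complex.exp_zero, add_comm]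
  rw [hankelQuot, h, hankelFun, hankelFun, add_mul, one_mul, Complex.exp_add, ← mul_assoc,
    mul_comm _ (Complex.exp w), mul_div_mul_left _ _ (Complex.exp_ne_zero _)]

theorem integrable_hankelQuot_line {ρ δ s : ℝ} {ℓ κ a : ℂ} (hρ : 0 < ρ)
    (hδ0 : 0 < δ) (hδ : δ < Real.pi) (hs : s ∈ Icc (-δ) δ)
    (h : Complex.exp κ = -Complex.exp (ρ * (ℓ + s * Complex.I))) (hκ : |κ.im| < Real.pi / 2)
    (ha : 0 < (a + 1).re) :
    Integrable (fun x : ℝ => hankelQuot ρ ℓ a (x + s * Complex.I)) := by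
  refine ((integrable_hankelFun_line hρ h hκ ha).norm.const_mul (Real.sin δ)⁻¹).mono'
    (Continuous.aestronglyMeasurable ?_)
    (ae_of_all _ fun x => norm_div_one_add_cexp_le hδ0 hδ _ x hs)
  exact ((continuous_hankelFun ρ ℓ _).comp (by fun_prop)).div (by fun_prop)
    fun x => one_add_cexp_ne_zero hδ0 hδ x hs

theorem hankelInt_hankelQuot {ρ δ : ℝ} {ℓ a : ℂ} (hρ : 0 < ρ)
    (hδ0 : 0 < δ) (hδ : δ < Real.pi)
    (hup : |ρ * (ℓ.im + δ) - Real.pi| < Real.pi / 2)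
    (hlo : |ρ * (ℓ.im - δ) + Real.pi| < Real.pi / 2) (ha : 0 < (a + 1).re) :
    hankelInt δ (hankelQuot ρ ℓ a)
      = ∫ x : ℝ, (hankelQuot ρ ℓ a (x + δ * Complex.I)
        - hankelQuot ρ ℓ a (x + (-δ : ℝ) * Complex.I)) := by
  have hI1 := integrable_hankelQuot_line hρ hδ0 hδ ⟨le_rfl, neg_le_self hδ0.le⟩
    (cexp_lower_eq ρ δ ℓ) (abs_im_lower hlo) ha
  have hI2 := integrable_hankelQuot_line hρ hδ0 hδ ⟨neg_le_self hδ0.le, le_rfl⟩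
    (cexp_upper_eq ρ δ ℓ) (abs_im_upper hup) ha
  rw [integral_sub hI2 hI1]
  refine hankelInt_eq_integral_sub (C := (Real.sin δ)⁻¹ *
    (Real.exp (Real.exp (ρ * (1 + ℓ.re))) * Real.exp (|(a + 1).im| * δ))) hδ0.le ha (fun w hw => ?_) (fun x y hx hy => ?_) hI1 hI2
  · refine (differentiable_hankelFun ρ ℓ _ w).div (by fun_prop) ?_
    have := one_add_cexp_ne_zero hδ0 hδ w.re hw
    rwa [Complex.re_add_im] at this
  · refine (norm_div_one_add_cexp_le hδ0 hδ _ x hy).trans ?_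
    refine (mul_le_mul_of_nonneg_left (norm_hankelFun_le hρ ℓ (a + 1) hx hy)
      (inv_nonneg.mpr (Real.sin_pos_of_pos_of_lt_pi hδ0 hδ).le)).trans_eq ?_
    rw [← mul_assoc]

theorem hasSum_mittagLefflerE {ρ δ : ℝ} {ℓ μ : ℂ} (hρ : 0 < ρ)
    (hδ0 : 0 < δ) (hup : |ρ * (ℓ.im + δ) - Real.pi| < Real.pi / 2)
    (hlo : |ρ * (ℓ.im - δ) + Real.pi| < Real.pi / 2) :
    HasSum (fun k : ℕ => (-Complex.exp ℓ) ^ k / Complex.Gamma (μ + (k : ℂ) / (ρ : ℂ)))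
      (ρ / (2 * Real.pi * Complex.I) * Complex.exp (ρ * (1 - μ) * ℓ)
        * hankelInt δ (hankelQuot ρ ℓ (ρ * (1 - μ)))) := by
  have h := (hasSum_hankelInt_hankelFun_div hρ hδ0.le hup hlo (ρ * (1 - μ))).mul_left
    (ρ / (2 * Real.pi * Complex.I) * Complex.exp (ρ * (1 - μ) * ℓ))
  rw [← hankelQuot_eq] at h
  convert! h using 2 with k
  have hρ' : (ρ : ℂ) ≠ 0 := by exact_mod_cast hρ.ne'
  have hpi : (Real.pi : ℂ) ≠ 0 := by exact_mod_cast Real.pi_ne_zero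
  have h1 : 1 - (ρ * (1 - μ) - k) / (ρ : ℂ) = μ + k / ρ := by field_simp; ring
  have h2 : Complex.exp (ρ * (1 - μ) * ℓ) * Complex.exp (-((ρ * (1 - μ) - k) * ℓ))
      = Complex.exp ℓ ^ k := by
    rw [← Complex.exp_add, ← Complex.exp_nat_mul]
    ring_nf
  rw [hankelInt_hankelFun hρ hδ0.le hup hlo, h1, neg_pow, ← h2]
  field_simp

/-! ### Branches of the powers and identification of the kernels. -/

theorem argCut_mul_ofReal (z : ℂ) {r : ℝ} (hr : 0 < r) : argCut (z * r) = argCut z := by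
  rw [argCut, argCut, Complex.arg_mul_real hr]

theorem neg_cexp_log_add_argCut {z : ℂ} (hz : z ≠ 0) :
    -Complex.exp ((Real.log ‖z‖ : ℝ) + ((argCut z - Real.pi : ℝ) : ℂ) * Complex.I) = z := by
  have h : Complex.exp ((argCut z : ℂ) * Complex.I) = Complex.exp (z.arg * Complex.I) := by
    rw [argCut]
    split_ifs
    · rfl
    · push_cast
      rw [add_mul, Complex.exp_add, Complex.exp_two_pi_mul_I, mul_one]
  rw [Complex.exp_add, Complex.ofReal_sub, sub_mul, Complex.exp_sub, Complex.exp_pi_mul_I, h,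
    ← Complex.ofReal_exp, Real.exp_log (norm_pos_iff.mpr hz)]
  rw [div_neg, div_one, mul_neg, neg_neg, Complex.norm_mul_exp_arg_mul_I]

theorem powCut_mul_exp {z : ℂ} (hz : z ≠ 0) (a : ℂ) (x : ℝ) :
    powCut (z * (Real.exp x : ℝ)) a
      = Complex.exp (a * (x + (Real.log ‖z‖ + argCut z * Complex.I))) := by
  rw [powCut, argCut_mul_ofReal z (Real.exp_pos x), norm_mul, Complex.norm_real,
    Real.norm_of_nonneg (Real.exp_pos x).le,
    Real.log_mul (norm_ne_zero_iff.mpr hz) (Real.exp_pos x).ne', Real.log_exp]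
  push_cast
  ring_nf

theorem powRot_mul_exp {z : ℂ} (hz : z ≠ 0) (a : ℂ) (x : ℝ) :
    powRot (z * (Real.exp x : ℝ)) a
      = Complex.exp (a * (x + ((Real.log ‖z‖ : ℝ)
          + ((argCut z - Real.pi : ℝ) : ℂ) * Complex.I))) := by
  rw [powRot, powCut_mul_exp hz, ← Complex.exp_add]
  push_cast
  ring_nf

theorem hankelQuot_line (ρ s x : ℝ) (ℓ a : ℂ) :
    hankelQuot ρ ℓ a (x + s * Complex.I)
      = Complex.exp (Complex.exp (ρ * (x + ℓ)) * Real.cos (ρ * s)) * Complex.exp (a * x)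
        * Complex.exp x * Complex.exp (s * Complex.I)
        * Complex.exp ((Complex.exp (ρ * (x + ℓ)) * Real.sin (ρ * s) + a * s) * Complex.I)
        / (1 + Complex.exp x * Complex.exp (s * Complex.I)) := by
  have h : Complex.exp (ρ * (x + s * Complex.I + ℓ)) = Complex.exp (ρ * (x + ℓ)) *
      (Real.cos (ρ * s) + Real.sin (ρ * s) * Complex.I) := by
    rw [show ρ * (x + s * Complex.I + ℓ) = ρ * (x + ℓ) + ((ρ * s : ℝ) : ℂ) * Complex.I by
      push_cast; ring, Complex.exp_add, Complex.exp_mul_I, Complex.ofReal_cos, Complex.ofReal_sin]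
  rw [hankelQuot, hankelFun, h, Complex.exp_add x]
  congr 1
  simp only [← Complex.exp_add]
  ring_nf

/-- With `d = e^{iδ}`, the denominator `r² + 2r cos δ + 1` factors as `(1+rd)(1+rd⁻¹)`. Over it, `d
e^{iη}/(1+rd) - d⁻¹ e^{-iη}/(1+rd⁻¹)` has numerator `2i (sin(η+δ) + r sin η)`. -/
theorem exp_smul_kernelML {ρ δ : ℝ} (hδ0 : 0 < δ) (hδ : δ < Real.pi) (μ : ℂ) {z ℓ : ℂ} (hz : z ≠ 0)
    (hℓ : ℓ = (Real.log ‖z‖ : ℝ) + ((argCut z - Real.pi : ℝ) : ℂ) * Complex.I) (x : ℝ) :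
    Real.exp x • kernelML ρ μ (Real.exp x) δ z
      = ρ / (2 * Real.pi * Complex.I) * Complex.exp (ρ * (1 - μ) * ℓ)
        * (hankelQuot ρ ℓ (ρ * (1 - μ)) (x + δ * Complex.I)
          - hankelQuot ρ ℓ (ρ * (1 - μ)) (x + (-δ : ℝ) * Complex.I)) := by
  set a : ℂ := ρ * (1 - μ) with ha
  set P : ℂ := Complex.exp (ρ * (x + ℓ)) with hP
  set r : ℂ := Complex.exp x with hr
  set d : ℂ := Complex.exp (δ * Complex.I) with hd
  set d' : ℂ := Complex.exp (-δ * Complex.I) with hd'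
  set η : ℂ := P * Real.sin (ρ * δ) + a * δ with hη
  have hdd : d * d' = 1 := by
    rw [hd, hd', ← Complex.exp_add, ← Complex.exp_zero]; ring_nf
  have hetaML : etaML ρ μ (Real.exp x) δ z = η := by
    rw [etaML, powCut_mul_exp hz, ← Complex.exp_add, hη, ← ha, hP, hℓ]
    push_cast
    ring_nf
  have hrot : powRot (z * (Real.exp x : ℝ)) ρ = P := by rw [powRot_mul_exp hz, ← hℓ]
  have hrota : powRot (z * (Real.exp x : ℝ)) a = Complex.exp (a * x) * Complex.exp (a * ℓ) := by
    rw [powRot_mul_exp hz, ← hℓ, ← Complex.exp_add]; ring_nf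
  have hup := hankelQuot_line ρ δ x ℓ a
  have hlo := hankelQuot_line ρ (-δ) x ℓ a
  rw [← hP, ← hr, ← hη, ← hd] at hup
  rw [← hP, ← hr, Complex.ofReal_neg, ← hd', mul_neg, Real.cos_neg, Real.sin_neg,
    Complex.ofReal_neg, show P * -(Real.sin (ρ * δ) : ℂ) + a * -(δ : ℂ) = -η by rw [hη]; ring,
    ← Complex.ofReal_neg] at hlo
  have hn1 : 1 + r * d ≠ 0 := by
    have := one_add_cexp_ne_zero hδ0 hδ x (y := δ) ⟨by linarith, le_rfl⟩
    rwa [Complex.exp_add] at this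
  have hn2 : 1 + r * d' ≠ 0 := by
    have := one_add_cexp_ne_zero hδ0 hδ x (y := -δ) ⟨le_rfl, by linarith⟩
    rwa [Complex.exp_add, Complex.ofReal_neg] at this
  have hD : ((Real.exp x ^ 2 + 2 * Real.exp x * Real.cos δ + 1 : ℝ) : ℂ)
      = (1 + r * d) * (1 + r * d') := by
    have hc : (Real.cos δ : ℂ) = (d + d') / 2 := by rw [Complex.ofReal_cos, Complex.cos]
    push_cast
    rw [← Complex.ofReal_cos, hc]
    linear_combination -r ^ 2 * hdd
  have hpi : (Real.pi : ℂ) ≠ 0 := by exact_mod_cast Real.pi_ne_zero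
  rw [kernelML, hetaML, hrot, hrota, hD, hup, hlo, Complex.real_smul, Complex.ofReal_exp, ← hr,
    Complex.sin, Complex.sin]
  rw [show (η + δ) * Complex.I = η * Complex.I + δ * Complex.I by ring,
    show -(η + δ) * Complex.I = -η * Complex.I + -δ * Complex.I by ring, Complex.exp_add,
    Complex.exp_add, ← hd, ← hd']
  field_simp
  linear_combination r * ρ * (r * (Complex.exp (-(η * Complex.I)) - Complex.exp (η * Complex.I))
    + (Complex.exp (-(η * Complex.I)) * d' - Complex.exp (η * Complex.I) * d)) * Complex.I_sq
    - r ^ 2 * ρ * (Complex.exp (η * Complex.I) - Complex.exp (-(η * Complex.I))) * hdd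

theorem integrableOn_kernelML_and_mittagLefflerE_eq {ρ δ : ℝ} {μ z : ℂ} (hρ : 0 < ρ)
    (hμ : μ.re < 1 + 1 / ρ) (hδ0 : 0 < δ) (hδ : δ < Real.pi) (hρδ : ρ * δ ≤ Real.pi) (hz : z ≠ 0)
    (h1 : Real.pi / (2 * ρ) - δ + Real.pi < argCut z)
    (h2 : argCut z < -(Real.pi / (2 * ρ)) + δ + Real.pi) :
    IntegrableOn (fun r : ℝ => kernelML ρ μ r δ z) (Ioi 0) ∧
      mittagLefflerE ρ μ z = ∫ r in Ioi (0 : ℝ), kernelML ρ μ r δ z := by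
  obtain ⟨ℓ, hℓ⟩ : ∃ ℓ : ℂ,
      ℓ = (Real.log ‖z‖ : ℝ) + ((argCut z - Real.pi : ℝ) : ℂ) * Complex.I := ⟨_, rfl⟩
  have him : ℓ.im = argCut z - Real.pi := by rw [hℓ]; simp
  have hzℓ : -Complex.exp ℓ = z := by rw [hℓ, neg_cexp_log_add_argCut hz]
  have hq : ρ * (Real.pi / (2 * ρ)) = Real.pi / 2 := by field_simp
  have h1' := mul_lt_mul_of_pos_left h1 hρ
  have h2' := mul_lt_mul_of_pos_left h2 hρ
  -- The lower bound is `h1`; the upper one combines `h2` with `ρδ ≤ π`, giving `2ρδ - π/2 ≤ 3π/2`.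
  -- The lower line is symmetric.
  have hup : |ρ * (ℓ.im + δ) - Real.pi| < Real.pi / 2 := by
    rw [him, abs_lt]
    constructor <;> nlinarith
  have hlo : |ρ * (ℓ.im - δ) + Real.pi| < Real.pi / 2 := by
    rw [him, abs_lt]
    constructor <;> nlinarith
  have ha : 0 < ((ρ : ℂ) * (1 - μ) + 1).re := by
    have h3 : ρ * (1 / ρ) = 1 := by field_simp
    have h4 := mul_lt_mul_of_pos_left hμ hρ
    rw [Complex.add_re, Complex.re_ofReal_mul, Complex.sub_re, Complex.one_re]
    linarith
  have hI1 := integrable_hankelQuot_line hρ hδ0 hδ ⟨le_rfl, neg_le_self hδ0.le⟩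
    (cexp_lower_eq ρ δ ℓ) (abs_im_lower hlo) ha
  have hI2 := integrable_hankelQuot_line hρ hδ0 hδ ⟨neg_le_self hδ0.le, le_rfl⟩
    (cexp_upper_eq ρ δ ℓ) (abs_im_upper hup) ha
  rw [integrableOn_Ioi_zero_iff_comp_exp, integral_Ioi_zero_eq_comp_exp]
  simp_rw [exp_smul_kernelML hδ0 hδ μ hz hℓ]
  refine ⟨(hI2.sub hI1).const_mul _, ?_⟩
  rw [integral_const_mul, ← hankelInt_hankelQuot hρ hδ0 hδ hup hlo ha, mittagLefflerE,
    ← (hasSum_mittagLefflerE hρ hδ0 hup hlo).tsum_eq, hzℓ]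

/-- At `ρδ = π` the sine in `η` vanishes, so `η` no longer depends on `r`, and the cosine in the
exponential is `-1`. -/
theorem kernelML₂_eq {ρ : ℝ} (hρ : 0 < ρ) (μ : ℂ) (r : ℝ) (z : ℂ) :
    kernelML₂ ρ μ r z = kernelML ρ μ r (Real.pi / ρ) z := by
  have h1 : ρ * (Real.pi / ρ) = Real.pi := by field_simp
  have h2 : etaML ρ μ r (Real.pi / ρ) z = Real.pi * (1 - μ) := by
    have hρ' : (ρ : ℂ) ≠ 0 := by exact_mod_cast hρ.ne'
    rw [etaML, h1, Real.sin_pi]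
    push_cast
    field_simp
    ring
  rw [kernelML, kernelML₂, h1, h2, Real.cos_pi]
  simp

end MittagLeffler

theorem corollary3 (ρ : ℝ) (hρ : 1 / 2 < ρ) (μ : ℂ) (hμ : μ.re < 1 + 1 / ρ) :
    (∀ (δ : ℝ) (z : ℂ),
      (1 < ρ → Real.pi / (2 * ρ) < δ ∧ δ ≤ Real.pi / ρ) →
      (ρ ≤ 1 → Real.pi / (2 * ρ) < δ ∧ δ < Real.pi) →
      z ≠ 0 →
      Real.pi / (2 * ρ) - δ + Real.pi < argCut z →
      argCut z < -(Real.pi / (2 * ρ)) + δ + Real.pi →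
      MeasureTheory.IntegrableOn (fun r : ℝ => kernelML ρ μ r δ z) (Set.Ioi 0) ∧
        mittagLefflerE ρ μ z = ∫ r in Set.Ioi (0 : ℝ), kernelML ρ μ r δ z) ∧
    (1 < ρ → ∀ z : ℂ,
      z ≠ 0 →
      Real.pi / (2 * ρ) - Real.pi / ρ + Real.pi < argCut z →
      argCut z < -(Real.pi / (2 * ρ)) + Real.pi / ρ + Real.pi →
      MeasureTheory.IntegrableOn (fun r : ℝ => kernelML₂ ρ μ r z) (Set.Ioi 0) ∧
        mittagLefflerE ρ μ z = ∫ r in Set.Ioi (0 : ℝ), kernelML₂ ρ μ r z) := by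
  have hρ0 : 0 < ρ := by linarith
  have hpos : 0 < Real.pi / (2 * ρ) := by positivity
  have hquot : ρ * (Real.pi / ρ) = Real.pi := by field_simp
  have hquot_lt : 1 < ρ → Real.pi / ρ < Real.pi := fun h => div_lt_self Real.pi_pos h
  refine ⟨fun δ z hgt hle hz h1 h2 => ?_, fun h z hz h1 h2 => ?_⟩
  -- Both ranges of `δ` give what the general statement needs: `0 < δ < π` and `ρδ ≤ π`.
  · rcases lt_or_ge 1 ρ with h | h
    · obtain ⟨hδ1, hδ2⟩ := hgt h
      refine integrableOn_kernelML_and_mittagLefflerE_eq hρ0 hμ (hpos.trans hδ1)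
        (hδ2.trans_lt (hquot_lt h)) ?_ hz h1 h2
      exact (mul_le_mul_of_nonneg_left hδ2 hρ0.le).trans_eq hquot
    · obtain ⟨hδ1, hδ2⟩ := hle h
      have hδ0 := hpos.trans hδ1
      refine integrableOn_kernelML_and_mittagLefflerE_eq hρ0 hμ hδ0 hδ2 ?_ hz h1 h2
      exact (mul_le_of_le_one_left hδ0.le h).trans hδ2.le
  · simp_rw [kernelML₂_eq hρ0]
    exact integrableOn_kernelML_and_mittagLefflerE_eq hρ0 hμ (by positivity) (hquot_lt h)
      hquot.le hz h1 h2
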